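/- **Notation.** $\|\cdot\|_2$ is the spectral norm, $\|\cdot\|_F$ the Frobenius norm, $A^\dagger$ the Moore–Penrose inverse, $\otimes$ the Kronecker product, $\mathrm{vec}$ stacks columns, $R_k$ is the reverse identity matrix of order $k$, and $X^{-T}=(X^{-1})^T$. A matrix $A\in\mathbb R^{m\times n}$ is centrosymmetric if $R_mAR_n=A$. For $1\le i\le n$ put $d(i)=\min(i,n+1-i)$. A centrosymmetric $X\in\mathbb R^{n\times n}$ is an $X$-type (double-cone) matrix if $x_{ij}=0$ whenever $d(i)>d(j)$. A QX factorization of $A\in\mathbb R^{m\times n}$ is $A=QX$ with $Q\in\mathbb R^{m\times n}$, $Q^TR_mQ=R_n$, $Q^TQ=I_n$, and $X\in\mathbb R^{n\times n}$ an $X$-type matrix. It is determined only up to signs; two $X$-type matrices $X,Y$ are said to have the same signs if for each $i$ and each choice of $\pm$ the numbers $x_{i,i}\pm x_{i,n+1-i}$ and $y_{i,i}\pm y_{i,n+1-i}$ have the same sign ($+$, $-$ or $0$). $M_{\mathrm{upx}}\in\mathbb R^{n^2\times n^2}$ is the matrix with $\mathrm{vec}(\mathrm{upx}(C))=M_{\mathrm{upx}}\mathrm{vec}(C)$,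 where $\mathrm{upx}(C)$ has the entries $c_{ij}$ if $d(i)<d(j)$, $\tfrac12c_{ij}$ if $d(i)=d(j)$, and $0$ if $d(i)>d(j)$. $M_{\mathrm{xvec}}$ is the $0$–$1$ matrix with $M_{\mathrm{xvec}}\mathrm{vec}(C)=\mathrm{xvec}(C)$, the vector of the entries $c_{ij}$ with $d(i)\le d(j)$. $\Pi_{m,n}$ is the permutation matrix with $\Pi_{m,n}\mathrm{vec}(E)=\mathrm{vec}(E^T)$ for $E\in\mathbb R^{m\times n}$. **Theorem.** Let $A\in\mathbb R^{m\times n}$ have full column rank $n$ and a QX factorization $A=QX$. Let $\Delta A\in\mathbb R^{m\times n}$ be centrosymmetric with $\|\Delta A\,A^\dagger\|_2<1$, and put $\delta=\|\Delta A\|_F$, $$G_X=M_{\mathrm{xvec}}(X^T\otimes I_n)M_{\mathrm{upx}}\big[(X^{-T}\otimes Q^T)+(Q^T\otimes X^{-T})\Pi_{m,n}\big],\qquad H_X=M_{\mathrm{xvec}}(X^T\otimes I_n)M_{\mathrm{upx}}(X^{-T}\otimes X^{-T}).$$ If $$\|H_X\|_2\big(\|G_X\|_2\delta+\|H_X\|_2\delta^2\big)<\tfrac14,$$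 then $A+\Delta A$ has a QX factorization $A+\Delta A=(Q+\Delta Q)(X+\Delta X)$ in which $X+\Delta X$ has the same signs as $X$; it is the only QX factorization of $A+\Delta A$ whose $X$-factor has the same signs as $X$, and also the only one satisfying the first of the bounds $$\|\Delta X\|_F\le\frac{2(\|G_X\|_2\delta+\|H_X\|_2\delta^2)}{1+\sqrt{1-4\|H_X\|_2(\|G_X\|_2\delta+\|H_X\|_2\delta^2)}}\le 2\big(\|G_X\|_2\delta+\|H_X\|_2\delta^2\big)\le(1+2\|G_X\|_2)\delta ,$$ all of which hold for it. -/

import Mathlib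

open scoped Kronecker Matrix

namespace QXFact

/-- The Frobenius norm of a real matrix. -/
noncomputable def frobNorm {m n : Type*} [Fintype m] [Fintype n] (A : Matrix m n ℝ) : ℝ :=
  (Matrix.frobeniusNormedAddCommGroup : NormedAddCommGroup (Matrix m n ℝ)).toNorm.norm A

/-- The spectral norm of a real matrix: the operator norm with respect to Euclidean norms. -/
noncomputable def specNorm {m n : Type*} [Fintype m] [Fintype n] [DecidableEq n]
    (A : Matrix m n ℝ) : ℝ :=
  (Matrix.instL2OpNormedAddCommGroup : NormedAddCommGroup (Matrix m n ℝ)).toNorm.norm A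

/-- The reverse identity matrix `R_n`. -/
def revId (n : ℕ) : Matrix (Fin n) (Fin n) ℝ :=
  Matrix.of fun i j => if j = Fin.rev i then 1 else 0

/-- `A` is centrosymmetric: `R_m A R_n = A`. -/
def IsCentrosymmetric {m n : ℕ} (A : Matrix (Fin m) (Fin n) ℝ) : Prop :=
  revId m * A * revId n = A

/-- The distance of an index from the nearer end of `{0, …, n-1}`. Indices `i` and `n-1-i` have
the same depth. -/
def depth {n : ℕ} (i : Fin n) : ℕ := min (i : ℕ) (Fin.rev i : ℕ)

/-- The positions of the double cone lying between the main diagonal and the antidiagonal,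
both included: (numbering from one) in the columns `j` and `n+1-j`, `j ≤ n/2`, the first `j` and
the last `j` rows. -/
def InCone {n : ℕ} (i j : Fin n) : Prop := depth i ≤ depth j

instance {n : ℕ} (i j : Fin n) : Decidable (InCone i j) :=
  inferInstanceAs (Decidable (depth i ≤ depth j))

/-- `X`-type matrices: square centrosymmetric matrices vanishing off the double cone. -/
structure IsXType {n : ℕ} (X : Matrix (Fin n) (Fin n) ℝ) : Prop where
  centro : IsCentrosymmetric X
  cone : ∀ i j, ¬ InCone i j → X i j = 0

/-- `A = Q X` is a (thin) QX factorization: `Q` is column perplectic orthogonal, i.e.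
`Qᵀ R_m Q = R_n` and `Qᵀ Q = I_n`, and `X` is an `X`-type matrix. -/
structure IsQX {m n : ℕ} (A Q : Matrix (Fin m) (Fin n) ℝ) (X : Matrix (Fin n) (Fin n) ℝ) :
    Prop where
  eq : A = Q * X
  perplectic : Qᵀ * revId m * Q = revId n
  orthogonal : Qᵀ * Q = 1
  xtype : IsXType X

/-- `X` and `Y` have the same signs on the crossing diagonals, that is,
`x_{i,i} ± x_{i,n+1-i}` has the same sign as `y_{i,i} ± y_{i,n+1-i}`, for every `i` and for both
choices of `±`. The numbers `x_{i,i} ± x_{i,n+1-i}` are the eigenvalues of the diagonal `2 × 2`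
blocks of the `X`-type matrix `X` (rows and columns `i`, `n+1-i`). -/
def SameSigns {n : ℕ} (X Y : Matrix (Fin n) (Fin n) ℝ) : Prop :=
  ∀ i, SignType.sign (X i i + X i (Fin.rev i)) = SignType.sign (Y i i + Y i (Fin.rev i)) ∧
    SignType.sign (X i i - X i (Fin.rev i)) = SignType.sign (Y i i - Y i (Fin.rev i))

/-- `P` is the Moore-Penrose inverse `A†` of the real matrix `A` (the four Penrose equations, which
have exactly one solution). -/
structure IsMoorePenrose {m n : ℕ} (A : Matrix (Fin m) (Fin n) ℝ)
    (P : Matrix (Fin n) (Fin m) ℝ) : Prop where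
  mul_mul_left : A * P * A = A
  mul_mul_right : P * A * P = P
  symm_left : (A * P)ᵀ = A * P
  symm_right : (P * A)ᵀ = P * A

/-- The operator `upx`: keep the entries in the double cone, halve those on the main diagonal and
on the antidiagonal, and annihilate the others. -/
noncomputable def upx {n : ℕ} (C : Matrix (Fin n) (Fin n) ℝ) : Matrix (Fin n) (Fin n) ℝ :=
  Matrix.of fun i j =>
    if depth i < depth j then C i j else if depth i = depth j then C i j / 2 else 0

/-- The operator `utx`: keep the entries in the double cone and annihilate the others. -/
def utx {n : ℕ} (C : Matrix (Fin n) (Fin n) ℝ) : Matrix (Fin n) (Fin n) ℝ :=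
  Matrix.of fun i j => if InCone i j then C i j else 0

/-- The index set of `xvec`: the positions `(column, row)` of the double cone. -/
abbrev ConeIdx (n : ℕ) : Type := {p : Fin n × Fin n // InCone p.2 p.1}

/-- The operator `xvec`: list the entries of the double cone, column by column. -/
def xvec {n : ℕ} (C : Matrix (Fin n) (Fin n) ℝ) : ConeIdx n → ℝ := fun p => C p.1.2 p.1.1

/-- The matrix of `upx` with respect to `vec`. -/
noncomputable def Mupx (n : ℕ) : Matrix (Fin n × Fin n) (Fin n × Fin n) ℝ :=
  Matrix.diagonal fun p =>
    if depth p.2 < depth p.1 then 1 else if depth p.2 = depth p.1 then 1 / 2 else 0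

/-- The matrix of `xvec` with respect to `vec`. -/
def Mxvec (n : ℕ) : Matrix (ConeIdx n) (Fin n × Fin n) ℝ :=
  Matrix.of fun p q => if p.1 = q then 1 else 0

/-- The vec-permutation matrix `Π_{m,n}`, with `Π_{m,n} vec E = vec Eᵀ` for `E` of size `m × n`. -/
def vecPerm (m n : ℕ) : Matrix (Fin m × Fin n) (Fin n × Fin m) ℝ :=
  Matrix.of fun p q => if q = p.swap then 1 else 0

theorem Mupx_mulVec_vec {n : ℕ} (C : Matrix (Fin n) (Fin n) ℝ) :
    Mupx n *ᵥ C.vec = (upx C).vec := by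
  ext p
  simp only [Mupx, Matrix.mulVec_diagonal, Matrix.vec, upx, Matrix.of_apply]
  split_ifs <;> ring

theorem Mxvec_mulVec_vec {n : ℕ} (C : Matrix (Fin n) (Fin n) ℝ) :
    Mxvec n *ᵥ C.vec = xvec C := by
  ext p
  simp [Mxvec, Matrix.mulVec, dotProduct, xvec]

theorem Mxvec_transpose_mulVec_xvec {n : ℕ} (C : Matrix (Fin n) (Fin n) ℝ) :
    (Mxvec n)ᵀ *ᵥ xvec C = (utx C).vec := by
  ext p
  by_cases h : InCone p.2 p.1
  · have : ∀ x : ConeIdx n, (x.1 = p) = (x = ⟨p, h⟩) := fun x => by simp [Subtype.ext_iff]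
    simp [Mxvec, Matrix.mulVec, dotProduct, xvec, utx, h, this]
  · have : ∀ x : ConeIdx n, x.1 ≠ p := fun x hx => h (hx ▸ x.2)
    simp [Mxvec, Matrix.mulVec, dotProduct, utx, h, this]

theorem vecPerm_mulVec_vec {m n : ℕ} (E : Matrix (Fin m) (Fin n) ℝ) :
    vecPerm m n *ᵥ E.vec = Eᵀ.vec := by
  ext p
  simp [vecPerm, Matrix.mulVec, dotProduct]

/-- `G_X = M_xvec (Xᵀ ⊗ I_n) M_upx [(X⁻ᵀ ⊗ Qᵀ) + (Qᵀ ⊗ X⁻ᵀ) Π_{m,n}]`. -/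
noncomputable def GX {m n : ℕ} (Q : Matrix (Fin m) (Fin n) ℝ) (X : Matrix (Fin n) (Fin n) ℝ) :
    Matrix (ConeIdx n) (Fin n × Fin m) ℝ :=
  Mxvec n * (Xᵀ ⊗ₖ (1 : Matrix (Fin n) (Fin n) ℝ)) * Mupx n *
    ((X⁻¹)ᵀ ⊗ₖ Qᵀ + (Qᵀ ⊗ₖ (X⁻¹)ᵀ) * vecPerm m n)

/-- `H_X = M_xvec (Xᵀ ⊗ I_n) M_upx (X⁻ᵀ ⊗ X⁻ᵀ)`. -/
noncomputable def HX {n : ℕ} (X : Matrix (Fin n) (Fin n) ℝ) :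
    Matrix (ConeIdx n) (Fin n × Fin n) ℝ :=
  Mxvec n * (Xᵀ ⊗ₖ (1 : Matrix (Fin n) (Fin n) ℝ)) * Mupx n * ((X⁻¹)ᵀ ⊗ₖ (X⁻¹)ᵀ)

/-- The quantity `‖G_X‖₂ δ + ‖H_X‖₂ δ²`. -/
noncomputable def pertTerm {m n : ℕ} (Q : Matrix (Fin m) (Fin n) ℝ)
    (X : Matrix (Fin n) (Fin n) ℝ) (δ : ℝ) : ℝ :=
  specNorm (GX Q X) * δ + specNorm (HX X) * δ ^ 2

/-- `2 (‖G_X‖₂ δ + ‖H_X‖₂ δ²) / (1 + √(1 - 4 ‖H_X‖₂ (‖G_X‖₂ δ + ‖H_X‖₂ δ²)))`. -/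
noncomputable def pertBound {m n : ℕ} (Q : Matrix (Fin m) (Fin n) ℝ)
    (X : Matrix (Fin n) (Fin n) ℝ) (δ : ℝ) : ℝ :=
  2 * pertTerm Q X δ / (1 + Real.sqrt (1 - 4 * specNorm (HX X) * pertTerm Q X δ))

end QXFact

/-! For a centrosymmetric `B` of full column rank, a QX factorization is the same as a nonsingular
X-type `Y` with `Yᵀ Y = Bᵀ B`; then `Q = B Y⁻¹` (`IsQX.gram_eq`, `isQX_of_gram_eq`). With `Y = X +
Z` and `B = A + ΔA`, multiplying the Gram equation by `X⁻ᵀ` and `X⁻¹` gives `Z X⁻¹ + (Z X⁻¹)ᵀ =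
C(Z)`, where `C(Z)` is symmetric and quadratic in `Z`. Since `upx C + (upx C)ᵀ = C`, every fixed
point of `Z ↦ upx (C(Z)) X` (`perturbMap`) is a solution.

`G_X` and `H_X` represent the linear pieces of this map. Writing `h = ‖H_X‖₂` and `t = pertTerm`,
the map is bounded by `t + h ‖Z‖²` and has Lipschitz constant `2hρ` on the ball of radius `ρ`.
Taking for `ρ` the smaller root of `t + hρ² = ρ`, which is `pertBound`, gives `2hρ < 1`, and
Banach's theorem applies.

Uniqueness rests on signs. The diagonal blocks of X-type matrices have common eigenvectors, so their
eigenvalues multiply; the signs and the Gram matrix together determine a nonsingular X-type matrix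
(`SameSigns.eq_of_gram_eq`). Each such eigenvalue `λ` of `X` satisfies `1 ≤ 2h|λ|`
(`IsBlockVec.one_le_two_mul_specNorm_HX`), so a perturbation of norm at most `ρ` cannot change its
sign. Hence the bound forces the signs, and both uniqueness claims coincide. -/

namespace QXFact

open Matrix

/-! ### The Frobenius and the spectral norm -/

section Norms

variable {m n p : Type*} [Fintype m] [Fintype n] [Fintype p]

theorem frobNorm_sq (A : Matrix m n ℝ) : frobNorm A ^ 2 = ∑ i, ∑ j, A i j ^ 2 := by
  have h : 0 ≤ ∑ i, ∑ j, A i j ^ 2 :=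
    Finset.sum_nonneg fun i _ => Finset.sum_nonneg fun j _ => sq_nonneg _
  have : frobNorm A = √(∑ i, ∑ j, A i j ^ 2) := by
    rw [frobNorm, Matrix.frobenius_norm_def, Real.sqrt_eq_rpow]
    simp
  rw [this, Real.sq_sqrt h]

theorem frobNorm_nonneg (A : Matrix m n ℝ) : 0 ≤ frobNorm A :=
  letI := (Matrix.frobeniusNormedAddCommGroup : NormedAddCommGroup (Matrix m n ℝ))
  norm_nonneg A

theorem frobNorm_mul_le (A : Matrix m n ℝ) (B : Matrix n p ℝ) :
    frobNorm (A * B) ≤ frobNorm A * frobNorm B :=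
  Matrix.frobenius_norm_mul A B

theorem frobNorm_transpose (A : Matrix m n ℝ) : frobNorm Aᵀ = frobNorm A :=
  Matrix.frobenius_norm_transpose A

theorem frobNorm_add_le (A B : Matrix m n ℝ) : frobNorm (A + B) ≤ frobNorm A + frobNorm B :=
  letI := (Matrix.frobeniusNormedAddCommGroup : NormedAddCommGroup (Matrix m n ℝ))
  norm_add_le A B

theorem frobNorm_sub_comm (A B : Matrix m n ℝ) : frobNorm (A - B) = frobNorm (B - A) :=
  letI := (Matrix.frobeniusNormedAddCommGroup : NormedAddCommGroup (Matrix m n ℝ))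
  norm_sub_rev A B

theorem frobNorm_sub_le (A B : Matrix m n ℝ) : frobNorm (A - B) ≤ frobNorm A + frobNorm B :=
  letI := (Matrix.frobeniusNormedAddCommGroup : NormedAddCommGroup (Matrix m n ℝ))
  norm_sub_le A B

theorem specNorm_nonneg [DecidableEq n] (A : Matrix m n ℝ) : 0 ≤ specNorm A :=
  letI := (Matrix.instL2OpNormedAddCommGroup : NormedAddCommGroup (Matrix m n ℝ))
  norm_nonneg A

theorem sum_mulVec_sq_le_specNorm [DecidableEq n] (A : Matrix m n ℝ) (x : n → ℝ) :
    ∑ i, (A *ᵥ x) i ^ 2 ≤ specNorm A ^ 2 * ∑ j, x j ^ 2 := by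
  have h := Matrix.l2_opNorm_mulVec A (WithLp.toLp 2 x)
  have h2 := pow_le_pow_left₀ (norm_nonneg _) h 2
  rw [mul_pow, EuclideanSpace.norm_sq_eq, EuclideanSpace.norm_sq_eq] at h2
  simpa [specNorm] using h2

theorem sum_mulVec_sq_le_frobNorm (A : Matrix m n ℝ) (x : n → ℝ) :
    ∑ i, (A *ᵥ x) i ^ 2 ≤ frobNorm A ^ 2 * ∑ j, x j ^ 2 := by
  rw [frobNorm_sq, Finset.sum_mul]
  exact Finset.sum_le_sum fun i _ => Finset.sum_mul_sq_le_sq_mul_sq _ _ _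

theorem sum_vec_sq (A : Matrix m n ℝ) : ∑ q, A.vec q ^ 2 = frobNorm A ^ 2 := by
  rw [frobNorm_sq, Fintype.sum_prod_type, Finset.sum_comm]
  rfl

/-- If `‖B P‖₂ < 1` with `P` a left inverse of `A`, then `A + B` is injective. -/
theorem mulVec_add_injective_of_specNorm_lt_one [DecidableEq m] [DecidableEq n]
    {A B : Matrix m n ℝ} {P : Matrix n m ℝ} (hP : P * A = 1) (h : specNorm (B * P) < 1) :
    Function.Injective (A + B).mulVec := by
  have key : ∀ x : n → ℝ, (A + B) *ᵥ x = 0 → x = 0 := by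
    intro x hx
    -- On the kernel of `A + B`, the matrix `B P` sends `A x` to `B x = -A x`, preserving its
    -- length; norm below one then forces `A x = 0`.
    have h1 : (B * P) *ᵥ (A *ᵥ x) = -(A *ᵥ x) := by
      rw [mulVec_mulVec, Matrix.mul_assoc, hP, Matrix.mul_one]
      rw [add_mulVec] at hx
      exact eq_neg_of_add_eq_zero_right hx
    have h2 := sum_mulVec_sq_le_specNorm (B * P) (A *ᵥ x)
    simp only [h1, Pi.neg_apply, neg_sq] at h2
    have h3 : 0 ≤ ∑ i, (A *ᵥ x) i ^ 2 := Finset.sum_nonneg fun i _ => sq_nonneg _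
    have h4 : specNorm (B * P) ^ 2 < 1 := by
      have := specNorm_nonneg (B * P); nlinarith
    have h5 : ∑ i, (A *ᵥ x) i ^ 2 = 0 := by nlinarith
    have h6 : A *ᵥ x = 0 := by
      ext i
      have := (Finset.sum_eq_zero_iff_of_nonneg fun i _ => sq_nonneg _).1 h5 i (Finset.mem_univ i)
      simpa using this
    have : (P * A) *ᵥ x = 0 := by rw [← mulVec_mulVec, h6, mulVec_zero]
    simpa [hP] using this
  intro x y hxy
  have := key (x - y) (by rw [mulVec_sub]; exact sub_eq_zero.2 hxy)
  exact sub_eq_zero.1 this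

end Norms

/-! ### A fixed point theorem -/

/-- Banach's fixed point theorem for a map which preserves a subspace and a ball. -/
theorem exists_fixedPoint_of_lipschitz {E : Type*} [NormedAddCommGroup E] [NormedSpace ℝ E]
    [FiniteDimensional ℝ E] (S : Submodule ℝ E) (Φ : E → E) {ρ K : ℝ} (hρ : 0 ≤ ρ) (hK : K < 1)
    (hS : ∀ z ∈ S, Φ z ∈ S) (hball : ∀ z ∈ S, ‖z‖ ≤ ρ → ‖Φ z‖ ≤ ρ)
    (hLip : ∀ z ∈ S, ∀ w ∈ S, ‖z‖ ≤ ρ → ‖w‖ ≤ ρ → ‖Φ z - Φ w‖ ≤ K * ‖z - w‖) :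
    ∃ z ∈ S, ‖z‖ ≤ ρ ∧ Φ z = z := by
  have : CompleteSpace E := FiniteDimensional.complete ℝ E
  let s : Set E := (S : Set E) ∩ Metric.closedBall 0 ρ
  have hs : IsComplete s := (S.closed_of_finiteDimensional.inter Metric.isClosed_closedBall).isComplete
  have hmaps : Set.MapsTo Φ s s := fun z hz =>
    ⟨hS z hz.1, by simpa using hball z hz.1 (by simpa using hz.2)⟩
  have hc : ContractingWith K.toNNReal (hmaps.restrict Φ s s) := by
    refine ⟨by simpa using hK, LipschitzWith.of_dist_le_mul fun z w => ?_⟩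
    have h := hLip z z.2.1 w w.2.1 (by simpa using z.2.2) (by simpa using w.2.2)
    rw [Subtype.dist_eq, Subtype.dist_eq, dist_eq_norm, dist_eq_norm]
    exact h.trans (mul_le_mul_of_nonneg_right (Real.le_coe_toNNReal K) (norm_nonneg _))
  obtain ⟨z, hz, hfix, -⟩ := hc.exists_fixedPoint' hs hmaps (x := 0)
    ⟨S.zero_mem, by simpa using hρ⟩ (edist_ne_top _ _)
  exact ⟨z, hz.1, by simpa using hz.2, hfix⟩

/-! ### Centrosymmetric matrices -/

section Centrosymmetric

variable {l m n : ℕ}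

theorem revId_mul (A : Matrix (Fin m) (Fin n) ℝ) : revId m * A = A.submatrix Fin.rev id := by
  ext i j
  simp [revId, Matrix.mul_apply]

theorem mul_revId (A : Matrix (Fin m) (Fin n) ℝ) : A * revId n = A.submatrix id Fin.rev := by
  ext i j
  have h : ∀ k, j = Fin.rev k ↔ k = Fin.rev j := fun k => by rw [← Fin.rev_eq_iff, eq_comm]
  simp [revId, Matrix.mul_apply, h]

theorem isCentrosymmetric_iff {A : Matrix (Fin m) (Fin n) ℝ} :
    IsCentrosymmetric A ↔ ∀ i j, A i.rev j.rev = A i j := by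
  simp [IsCentrosymmetric, revId_mul, mul_revId, ← Matrix.ext_iff]

theorem revId_mul_revId : revId n * revId n = 1 := by
  ext i j
  rw [revId_mul]
  simp [revId, Matrix.one_apply, eq_comm]

theorem transpose_revId : (revId n)ᵀ = revId n := by
  ext i j
  have h : i = Fin.rev j ↔ j = Fin.rev i := by rw [← Fin.rev_eq_iff, eq_comm]
  simp [revId, h]

theorem isCentrosymmetric_iff_comm {A : Matrix (Fin m) (Fin n) ℝ} :
    IsCentrosymmetric A ↔ revId m * A = A * revId n := by
  constructor
  · intro h
    rw [IsCentrosymmetric] at h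
    conv_rhs => rw [← h, Matrix.mul_assoc, revId_mul_revId, Matrix.mul_one]
  · intro h
    rw [IsCentrosymmetric, h, Matrix.mul_assoc, revId_mul_revId, Matrix.mul_one]

theorem IsCentrosymmetric.mul {A : Matrix (Fin l) (Fin m) ℝ} {B : Matrix (Fin m) (Fin n) ℝ}
    (hA : IsCentrosymmetric A) (hB : IsCentrosymmetric B) : IsCentrosymmetric (A * B) := by
  rw [isCentrosymmetric_iff_comm] at *
  rw [← Matrix.mul_assoc, hA, Matrix.mul_assoc, hB, Matrix.mul_assoc]

theorem IsCentrosymmetric.add {A B : Matrix (Fin m) (Fin n) ℝ}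
    (hA : IsCentrosymmetric A) (hB : IsCentrosymmetric B) : IsCentrosymmetric (A + B) := by
  rw [isCentrosymmetric_iff] at *
  simp [hA, hB]

theorem IsCentrosymmetric.sub {A B : Matrix (Fin m) (Fin n) ℝ}
    (hA : IsCentrosymmetric A) (hB : IsCentrosymmetric B) : IsCentrosymmetric (A - B) := by
  rw [isCentrosymmetric_iff] at *
  simp [hA, hB]

theorem IsCentrosymmetric.smul {A : Matrix (Fin m) (Fin n) ℝ} (c : ℝ)
    (hA : IsCentrosymmetric A) : IsCentrosymmetric (c • A) := by
  rw [isCentrosymmetric_iff] at *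
  simp [hA]

theorem IsCentrosymmetric.transpose {A : Matrix (Fin m) (Fin n) ℝ}
    (hA : IsCentrosymmetric A) : IsCentrosymmetric Aᵀ := by
  rw [isCentrosymmetric_iff] at *
  simp [hA]

theorem IsCentrosymmetric.inv {A : Matrix (Fin n) (Fin n) ℝ}
    (hA : IsCentrosymmetric A) : IsCentrosymmetric A⁻¹ := by
  rw [IsCentrosymmetric] at *
  conv_rhs => rw [← hA]
  have h : (revId n)⁻¹ = revId n := Matrix.inv_eq_right_inv revId_mul_revId
  rw [Matrix.mul_inv_rev, Matrix.mul_inv_rev, h, Matrix.mul_assoc]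

theorem perplectic_of_isCentrosymmetric {Q : Matrix (Fin m) (Fin n) ℝ}
    (hQ : IsCentrosymmetric Q) (hQQ : Qᵀ * Q = 1) : Qᵀ * revId m * Q = revId n := by
  rw [isCentrosymmetric_iff_comm] at hQ
  rw [Matrix.mul_assoc, hQ, ← Matrix.mul_assoc, hQQ, Matrix.one_mul]

/-- With `D = R Q - Q R`, each of the four products in `Dᵀ D` is the identity, so they cancel and `D
= 0`. This also works for rectangular `Q`. -/
theorem isCentrosymmetric_of_perplectic {Q : Matrix (Fin m) (Fin n) ℝ}
    (hR : Qᵀ * revId m * Q = revId n) (hQQ : Qᵀ * Q = 1) : IsCentrosymmetric Q := by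
  rw [isCentrosymmetric_iff_comm, ← sub_eq_zero]
  have h : (revId m * Q - Q * revId n)ᴴ * (revId m * Q - Q * revId n) = 0 := by
    have h1 : Qᵀ * revId m * (revId m * Q) = 1 := by
      rw [Matrix.mul_assoc, ← Matrix.mul_assoc (revId m), revId_mul_revId, Matrix.one_mul, hQQ]
    have h2 : Qᵀ * revId m * (Q * revId n) = 1 := by
      rw [← Matrix.mul_assoc, hR, revId_mul_revId]
    have h3 : revId n * Qᵀ * (revId m * Q) = 1 := by
      rw [Matrix.mul_assoc, ← Matrix.mul_assoc Qᵀ, hR, revId_mul_revId]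
    have h4 : revId n * Qᵀ * (Q * revId n) = 1 := by
      rw [Matrix.mul_assoc, ← Matrix.mul_assoc Qᵀ, hQQ, Matrix.one_mul, revId_mul_revId]
    rw [conjTranspose_eq_transpose_of_trivial, transpose_sub, transpose_mul, transpose_mul,
      transpose_revId, transpose_revId, Matrix.sub_mul, Matrix.mul_sub, Matrix.mul_sub,
      h1, h2, h3, h4]
    simp
  exact conjTranspose_mul_self_eq_zero.1 h

end Centrosymmetric

/-! ### X-type matrices and the operator `upx` -/

section XType

variable {m n : ℕ}

theorem depth_rev (i : Fin n) : depth i.rev = depth i := by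
  simp [depth, min_comm]

theorem depth_eq_depth_iff {i j : Fin n} : depth i = depth j ↔ i = j ∨ i = j.rev := by
  simp only [depth, Fin.val_rev, Fin.ext_iff]
  omega

/-- The cone condition is block triangularity for `depth`, which gives closure under products and
inverses. -/
theorem IsXType.blockTriangular {X : Matrix (Fin n) (Fin n) ℝ} (hX : IsXType X) :
    BlockTriangular X depth := fun i j h => hX.cone i j (not_le.2 h)

theorem isXType_of_blockTriangular {X : Matrix (Fin n) (Fin n) ℝ} (hc : IsCentrosymmetric X)
    (hX : BlockTriangular X depth) : IsXType X :=
  ⟨hc, fun _ _ h => hX (not_le.1 h)⟩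

theorem IsXType.mul {X Y : Matrix (Fin n) (Fin n) ℝ} (hX : IsXType X) (hY : IsXType Y) :
    IsXType (X * Y) :=
  isXType_of_blockTriangular (hX.centro.mul hY.centro) (hX.blockTriangular.mul hY.blockTriangular)

theorem IsXType.add {X Y : Matrix (Fin n) (Fin n) ℝ} (hX : IsXType X) (hY : IsXType Y) :
    IsXType (X + Y) :=
  isXType_of_blockTriangular (hX.centro.add hY.centro) (hX.blockTriangular.add hY.blockTriangular)

theorem IsXType.sub {X Y : Matrix (Fin n) (Fin n) ℝ} (hX : IsXType X) (hY : IsXType Y) :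
    IsXType (X - Y) :=
  isXType_of_blockTriangular (hX.centro.sub hY.centro) (hX.blockTriangular.sub hY.blockTriangular)

theorem IsXType.smul {X : Matrix (Fin n) (Fin n) ℝ} (c : ℝ) (hX : IsXType X) : IsXType (c • X) :=
  ⟨hX.centro.smul c, fun i j h => by simp [hX.cone i j h]⟩

theorem isXType_zero : IsXType (0 : Matrix (Fin n) (Fin n) ℝ) :=
  ⟨by simp [isCentrosymmetric_iff], fun _ _ _ => rfl⟩

theorem IsXType.inv {X : Matrix (Fin n) (Fin n) ℝ} (hX : IsXType X) (hu : IsUnit X) :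
    IsXType X⁻¹ :=
  letI := hu.invertible
  isXType_of_blockTriangular hX.centro.inv
    (blockTriangular_inv_of_blockTriangular hX.blockTriangular)

/-- The X-type matrices form a subspace. -/
def xTypeSubmodule (n : ℕ) : Submodule ℝ (Matrix (Fin n) (Fin n) ℝ) where
  carrier := {X | IsXType X}
  add_mem' := IsXType.add
  zero_mem' := isXType_zero
  smul_mem' c _ h := IsXType.smul c h

theorem upx_cone (C : Matrix (Fin n) (Fin n) ℝ) (i j : Fin n) (h : ¬ InCone i j) :
    upx C i j = 0 := by
  have h' := not_le.1 h
  simp [upx, h'.not_gt, h'.ne']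

theorem isXType_upx {C : Matrix (Fin n) (Fin n) ℝ} (hC : IsCentrosymmetric C) :
    IsXType (upx C) := by
  refine ⟨?_, upx_cone C⟩
  rw [isCentrosymmetric_iff] at *
  simp [upx, hC, depth_rev]

theorem upx_sub (C D : Matrix (Fin n) (Fin n) ℝ) : upx (C - D) = upx C - upx D := by
  ext i j
  simp only [upx, of_apply, Matrix.sub_apply]
  split_ifs <;> ring

theorem upx_add (C D : Matrix (Fin n) (Fin n) ℝ) : upx (C + D) = upx C + upx D := by
  ext i j
  simp only [upx, of_apply, Matrix.add_apply]
  split_ifs <;> ring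

/-- The halving in `upx` serves this identity: positions of equal depth are counted twice, all
others once. -/
theorem upx_add_transpose_upx {C : Matrix (Fin n) (Fin n) ℝ} (hC : Cᵀ = C) :
    upx C + (upx C)ᵀ = C := by
  ext i j
  have h : C j i = C i j := congrFun₂ hC i j
  simp only [upx, of_apply, Matrix.add_apply, transpose_apply, h]
  rcases lt_trichotomy (depth i) (depth j) with h | h | h
  · simp [h, h.not_gt, h.ne']
  · simp [h]
  · simp [h, h.not_gt, h.ne']

theorem upx_mul_cone (C : Matrix (Fin n) (Fin n) ℝ) {X : Matrix (Fin n) (Fin n) ℝ}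
    (hX : IsXType X) (i j : Fin n) (h : ¬ InCone i j) : (upx C * X) i j = 0 :=
  BlockTriangular.mul (M := upx C) (fun i j h => upx_cone C i j (not_le.2 h))
    hX.blockTriangular (not_le.1 h)

/-- Only zeros are dropped by `xvec`, so Euclidean estimates for `G_X` and `H_X` become Frobenius
estimates. -/
theorem sum_xvec_sq {Y : Matrix (Fin n) (Fin n) ℝ} (hY : ∀ i j, ¬ InCone i j → Y i j = 0) :
    ∑ p, xvec Y p ^ 2 = frobNorm Y ^ 2 := by
  rw [← sum_vec_sq]
  have h := Finset.sum_subtype_eq_sum_filter (s := (Finset.univ : Finset (Fin n × Fin n)))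
    (fun p => Y p.2 p.1 ^ 2) (p := fun p => InCone p.2 p.1)
  rw [Finset.subtype_univ] at h
  refine h.trans (Finset.sum_filter_of_ne fun p _ hp => ?_)
  by_contra hc
  exact hp (by simp [hY _ _ hc])

theorem HX_mulVec_vec (X W : Matrix (Fin n) (Fin n) ℝ) :
    HX X *ᵥ W.vec = xvec (upx ((X⁻¹)ᵀ * W * X⁻¹) * X) := by
  rw [HX, ← mulVec_mulVec, kronecker_mulVec_vec, ← mulVec_mulVec, Mupx_mulVec_vec,
    ← mulVec_mulVec, kronecker_mulVec_vec, Mxvec_mulVec_vec, Matrix.one_mul,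
    transpose_transpose, transpose_transpose]

theorem GX_mulVec_vec (Q E : Matrix (Fin m) (Fin n) ℝ) (X : Matrix (Fin n) (Fin n) ℝ) :
    GX Q X *ᵥ E.vec = xvec (upx (Qᵀ * E * X⁻¹ + (X⁻¹)ᵀ * Eᵀ * Q) * X) := by
  rw [GX, ← mulVec_mulVec, add_mulVec, kronecker_mulVec_vec,
    ← mulVec_mulVec E.vec, vecPerm_mulVec_vec, kronecker_mulVec_vec, ← vec_add, ← mulVec_mulVec, Mupx_mulVec_vec,
    ← mulVec_mulVec, kronecker_mulVec_vec, Mxvec_mulVec_vec, Matrix.one_mul,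
    transpose_transpose, transpose_transpose, transpose_transpose]

theorem frobNorm_le_specNorm_mul {p q : Type*} [Fintype p] [Fintype q] [DecidableEq p]
    [DecidableEq q] {M : Matrix (ConeIdx n) (q × p) ℝ} {E : Matrix p q ℝ}
    {Y : Matrix (Fin n) (Fin n) ℝ}
    (hY : ∀ i j, ¬ InCone i j → Y i j = 0) (h : M *ᵥ E.vec = xvec Y) :
    frobNorm Y ≤ specNorm M * frobNorm E := by
  have h1 := sum_mulVec_sq_le_specNorm M E.vec
  rw [h, sum_xvec_sq hY, sum_vec_sq, ← mul_pow] at h1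
  exact (pow_le_pow_iff_left₀ (frobNorm_nonneg _)
    (mul_nonneg (specNorm_nonneg _) (frobNorm_nonneg _)) two_ne_zero).1 h1

theorem frobNorm_upx_mul_le_HX {X : Matrix (Fin n) (Fin n) ℝ} (hX : IsXType X)
    (W : Matrix (Fin n) (Fin n) ℝ) :
    frobNorm (upx ((X⁻¹)ᵀ * W * X⁻¹) * X) ≤ specNorm (HX X) * frobNorm W :=
  frobNorm_le_specNorm_mul (upx_mul_cone _ hX) (HX_mulVec_vec X W)

theorem frobNorm_upx_mul_le_GX {X : Matrix (Fin n) (Fin n) ℝ} (hX : IsXType X)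
    (Q E : Matrix (Fin m) (Fin n) ℝ) :
    frobNorm (upx (Qᵀ * E * X⁻¹ + (X⁻¹)ᵀ * Eᵀ * Q) * X) ≤ specNorm (GX Q X) * frobNorm E :=
  frobNorm_le_specNorm_mul (upx_mul_cone _ hX) (GX_mulVec_vec Q E X)

end XType

/-! ### Eigenvalues of the diagonal blocks of X-type matrices -/

/-- `v` is a vector supported on the positions `i`, `n-1-i`, symmetric (`s = 1`) or skew-symmetric
(`s = -1`) under reversal, and normalized by `v i = 1`. Such vectors are the common eigenvectors of
the diagonal blocks of order two of centrosymmetric matrices. -/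
structure IsBlockVec {n : ℕ} (i : Fin n) (s : ℝ) (v : Fin n → ℝ) : Prop where
  apply_self : v i = 1
  apply_rev : ∀ k, v k.rev = s * v k
  eq_zero : ∀ k, depth k ≠ depth i → v k = 0

/-- The eigenvalue of the diagonal block `{i, n-1-i}` of `X` on the block vector `v`. -/
noncomputable def blockEig {n : ℕ} (i : Fin n) (v : Fin n → ℝ) (X : Matrix (Fin n) (Fin n) ℝ) : ℝ :=
  (X *ᵥ v) i

section BlockEig

variable {n : ℕ} {i : Fin n} {s : ℝ} {v : Fin n → ℝ} {X Y : Matrix (Fin n) (Fin n) ℝ}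

/-- A centrosymmetric `X` commutes with reversal, so `X v` has the parity `s` of `v`; its value at
`i` then fixes the one at `i.rev`. -/
theorem IsBlockVec.mulVec_apply (hv : IsBlockVec i s v) (hX : IsCentrosymmetric X) {k : Fin n}
    (hk : depth k = depth i) : (X *ᵥ v) k = blockEig i v X * v k := by
  have hrev : ∀ k, (X *ᵥ v) k.rev = s * (X *ᵥ v) k := by
    intro k
    rw [isCentrosymmetric_iff] at hX
    simp only [mulVec, dotProduct, Finset.mul_sum]
    rw [← Equiv.sum_comp Fin.revPerm]
    refine Finset.sum_congr rfl fun j _ => ?_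
    rw [Fin.revPerm_apply, hX, hv.apply_rev]
    ring
  rcases depth_eq_depth_iff.1 hk with rfl | rfl
  · rw [hv.apply_self, mul_one, blockEig]
  · rw [hrev, hv.apply_rev, hv.apply_self, blockEig]
    ring

/-- The hypothesis kills the cross-depth terms. It is weaker than both factors being X-type, because
it is also needed with the transposed factor `X⁻ᵀ` on the left. -/
theorem IsBlockVec.blockEig_mul (hv : IsBlockVec i s v) (hY : IsCentrosymmetric Y)
    (h : ∀ k, depth k ≠ depth i → X i k = 0 ∨ (Y *ᵥ v) k = 0) :
    blockEig i v (X * Y) = blockEig i v X * blockEig i v Y := by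
  rw [blockEig, ← mulVec_mulVec, blockEig, mulVec, dotProduct, mulVec, dotProduct, Finset.sum_mul]
  refine Finset.sum_congr rfl fun k _ => ?_
  by_cases hk : depth k = depth i
  · rw [hv.mulVec_apply hY hk]
    ring
  · rw [hv.eq_zero k hk]
    rcases h k hk with h | h <;> simp [h]

theorem IsBlockVec.mulVec_eq_zero_of_lt (hv : IsBlockVec i s v) (hX : IsXType X) {k : Fin n}
    (hk : depth i < depth k) : (X *ᵥ v) k = 0 := by
  rw [mulVec, dotProduct]
  refine Finset.sum_eq_zero fun j _ => ?_
  by_cases hj : depth j = depth i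
  · rw [hX.blockTriangular (hj ▸ hk), zero_mul]
  · rw [hv.eq_zero j hj, mul_zero]

theorem IsBlockVec.blockEig_mul_of_isXType (hv : IsBlockVec i s v) (hX : IsXType X)
    (hY : IsXType Y) : blockEig i v (X * Y) = blockEig i v X * blockEig i v Y :=
  hv.blockEig_mul hY.centro fun _ hk => (lt_or_gt_of_ne hk).imp
    (fun h => hX.blockTriangular h) (fun h => hv.mulVec_eq_zero_of_lt hY h)

theorem IsBlockVec.blockEig_one (hv : IsBlockVec i s v) :
    blockEig i v (1 : Matrix (Fin n) (Fin n) ℝ) = 1 := by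
  rw [blockEig, one_mulVec, hv.apply_self]

theorem IsBlockVec.sum_sq_pos (hv : IsBlockVec i s v) : 0 < ∑ k, v k ^ 2 :=
  Finset.sum_pos' (fun _ _ => sq_nonneg _) ⟨i, Finset.mem_univ i, by simp [hv.apply_self]⟩

/-- On centrosymmetric matrices `blockEig` is a Rayleigh quotient. -/
theorem IsBlockVec.blockEig_mul_sum_sq (hv : IsBlockVec i s v) (hX : IsCentrosymmetric X) :
    blockEig i v X * ∑ k, v k ^ 2 = v ⬝ᵥ X *ᵥ v := by
  rw [Finset.mul_sum, dotProduct]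
  refine Finset.sum_congr rfl fun k _ => ?_
  by_cases hk : depth k = depth i
  · rw [hv.mulVec_apply hX hk]
    ring
  · simp [hv.eq_zero k hk]

/-- Transposition does not change the quadratic form `v ⬝ᵥ X v`. -/
theorem IsBlockVec.blockEig_transpose (hv : IsBlockVec i s v) (hX : IsCentrosymmetric X) :
    blockEig i v Xᵀ = blockEig i v X := by
  have h := hv.blockEig_mul_sum_sq hX.transpose
  rw [mulVec_transpose, dotProduct_comm, ← dotProduct_mulVec, ← hv.blockEig_mul_sum_sq hX] at h
  exact mul_right_cancel₀ hv.sum_sq_pos.ne' h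

theorem IsBlockVec.abs_blockEig_le (hv : IsBlockVec i s v) (hX : IsCentrosymmetric X) :
    |blockEig i v X| ≤ frobNorm X := by
  have h : blockEig i v X ^ 2 * ∑ k, v k ^ 2 ≤ frobNorm X ^ 2 * ∑ k, v k ^ 2 := by
    refine le_trans ?_ (sum_mulVec_sq_le_frobNorm X v)
    rw [Finset.mul_sum]
    refine Finset.sum_le_sum fun k _ => ?_
    by_cases hk : depth k = depth i
    · rw [hv.mulVec_apply hX hk, mul_pow]
    · rw [hv.eq_zero k hk]
      nlinarith [sq_nonneg ((X *ᵥ v) k)]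
  exact abs_le_of_sq_le_sq (le_of_mul_le_mul_right h hv.sum_sq_pos) (frobNorm_nonneg X)

theorem IsBlockVec.blockEig_upx (hv : IsBlockVec i s v) (C : Matrix (Fin n) (Fin n) ℝ) :
    blockEig i v (upx C) = blockEig i v C / 2 := by
  rw [blockEig, blockEig, mulVec, dotProduct, mulVec, dotProduct, Finset.sum_div]
  refine Finset.sum_congr rfl fun k _ => ?_
  by_cases hk : depth k = depth i
  · simp [upx, hk]
    ring
  · simp [hv.eq_zero k hk]

/-- The rank one orthogonal projection onto the line of `v`. -/
noncomputable def lineProj (v : Fin n → ℝ) : Matrix (Fin n) (Fin n) ℝ :=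
  (∑ k, v k ^ 2)⁻¹ • vecMulVec v v

theorem IsBlockVec.frobNorm_lineProj (hv : IsBlockVec i s v) : frobNorm (lineProj v) = 1 := by
  have h : frobNorm (lineProj v) ^ 2 = 1 := by
    rw [frobNorm_sq]
    have : ∀ k l, lineProj v k l ^ 2 = (∑ k, v k ^ 2)⁻¹ ^ 2 * (v k ^ 2 * v l ^ 2) := by
      intro k l
      simp only [lineProj, Matrix.smul_apply, vecMulVec_apply, smul_eq_mul]
      ring
    simp_rw [this, ← Finset.mul_sum, ← Finset.sum_mul]
    have := hv.sum_sq_pos.ne'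
    field_simp
  nlinarith [frobNorm_nonneg (lineProj v)]

theorem IsBlockVec.isXType_lineProj (hv : IsBlockVec i s v) (hs : s ^ 2 = 1) :
    IsXType (lineProj v) := by
  refine IsXType.smul _ ⟨?_, fun k l hkl => ?_⟩
  · rw [isCentrosymmetric_iff]
    intro k l
    rw [vecMulVec_apply, hv.apply_rev, hv.apply_rev, vecMulVec_apply]
    linear_combination v k * v l * hs
  · rw [vecMulVec_apply, mul_eq_zero]
    by_contra! hc
    have h1 : depth k = depth i := by_contra fun h => hc.1 (hv.eq_zero k h)
    have h2 : depth l = depth i := by_contra fun h => hc.2 (hv.eq_zero l h)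
    exact hkl (h1.trans h2.symm).le

theorem IsBlockVec.blockEig_lineProj (hv : IsBlockVec i s v) : blockEig i v (lineProj v) = 1 := by
  have := hv.sum_sq_pos.ne'
  simp [blockEig, lineProj, smul_mulVec, vecMulVec_mulVec, hv.apply_self, dotProduct, ← sq, this]

/-- The spectral norm of `H_X` bounds the reciprocals of the eigenvalues of the diagonal blocks. -/
theorem IsBlockVec.one_le_two_mul_specNorm_HX (hv : IsBlockVec i s v) (hs : s ^ 2 = 1)
    (hX : IsXType X) (hu : IsUnit X) : 1 ≤ 2 * specNorm (HX X) * |blockEig i v X| := by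
  have hd := (Matrix.isUnit_iff_isUnit_det X).1 hu
  have hW := hv.isXType_lineProj hs
  have hXi := hX.inv hu
  have hinv : blockEig i v X⁻¹ * blockEig i v X = 1 := by
    rw [← hv.blockEig_mul_of_isXType hXi hX, nonsing_inv_mul _ hd, hv.blockEig_one]
  -- `H_X` is tested on the projection onto `v`. With `μ = λ⁻¹` the eigenvalue of `X⁻¹`, the
  -- conjugated projection has eigenvalue `μ²`; `upx` halves it and the factor `X` leaves `μ / 2`,
  -- whence `|μ| / 2 ≤ ‖H_X‖₂`.
  have hC : blockEig i v ((X⁻¹)ᵀ * lineProj v * X⁻¹) = blockEig i v X⁻¹ ^ 2 := by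
    rw [Matrix.mul_assoc, hv.blockEig_mul (hW.mul hXi).centro, hv.blockEig_transpose hXi.centro,
      hv.blockEig_mul_of_isXType hW hXi, hv.blockEig_lineProj]
    · ring
    · intro k hk
      right
      rw [← mulVec_mulVec, lineProj, smul_mulVec, vecMulVec_mulVec]
      simp [hv.eq_zero k hk]
  have hcen : IsCentrosymmetric ((X⁻¹)ᵀ * lineProj v * X⁻¹) :=
    (hXi.centro.transpose.mul hW.centro).mul hXi.centro
  have hT : blockEig i v (upx ((X⁻¹)ᵀ * lineProj v * X⁻¹) * X) = blockEig i v X⁻¹ / 2 := by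
    rw [hv.blockEig_mul_of_isXType (isXType_upx hcen) hX, hv.blockEig_upx, hC]
    linear_combination blockEig i v X⁻¹ / 2 * hinv
  have h1 := (hv.abs_blockEig_le ((isXType_upx hcen).mul hX).centro).trans
    (frobNorm_upx_mul_le_HX hX (lineProj v))
  rw [hT, hv.frobNorm_lineProj, mul_one, abs_div, abs_two] at h1
  have h2 : |blockEig i v X⁻¹| * |blockEig i v X| = 1 := by rw [← abs_mul, hinv, abs_one]
  rw [← h2]
  exact mul_le_mul_of_nonneg_right (by linarith) (abs_nonneg _)

end BlockEig

/-! ### Signs -/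

section Signs

variable {n : ℕ} {X Y : Matrix (Fin n) (Fin n) ℝ}

theorem isBlockVec_single {i : Fin n} (h : i.rev = i) : IsBlockVec i 1 (Pi.single i 1) := by
  refine ⟨by simp, fun k => ?_, fun k hk => ?_⟩
  · have : k.rev = i ↔ k = i := by rw [Fin.rev_eq_iff, h]
    simp [Pi.single_apply, this]
  · rw [Pi.single_eq_of_ne]
    rintro rfl
    exact hk rfl

theorem isBlockVec_add_single {i : Fin n} {s : ℝ} (h : i.rev ≠ i) (hs : s ^ 2 = 1) :
    IsBlockVec i s (Pi.single i 1 + Pi.single i.rev s) := by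
  refine ⟨by simp [h.symm], fun k => ?_, fun k hk => ?_⟩
  · by_cases h1 : k = i
    · subst h1
      simp [h, h.symm]
    · by_cases h2 : k = i.rev
      · subst h2
        simp [h, h.symm, ← sq, hs]
      · have h3 : k.rev ≠ i := fun h => h2 (by rw [← h, Fin.rev_rev])
        simp [h1, h2, h3]
  · have h1 : k ≠ i := fun h => hk (by rw [h])
    have h2 : k ≠ i.rev := fun h => hk (by rw [h, depth_rev])
    simp [h1, h2]

theorem blockEig_single (i : Fin n) : blockEig i (Pi.single i 1) X = X i i := by
  simp [blockEig]

theorem blockEig_add_single (i : Fin n) (s : ℝ) :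
    blockEig i (Pi.single i 1 + Pi.single i.rev s) X = X i i + s * X i i.rev := by
  simp [blockEig, mulVec_add]

theorem sameSigns_of_blockEig
    (h : ∀ i s v, s ^ 2 = 1 → IsBlockVec i s v →
      SignType.sign (blockEig i v X) = SignType.sign (blockEig i v Y)) : SameSigns X Y := by
  intro i
  by_cases hi : i.rev = i
  · have h1 := h i 1 _ (by norm_num) (isBlockVec_single hi)
    rw [blockEig_single, blockEig_single] at h1
    -- At the central index of odd order the two numbers are `2 x_ii` and `0`, so only the symmetric
    -- vector matters.
    rw [hi, sub_self, sub_self, ← two_mul, ← two_mul, sign_mul, sign_mul, h1]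
    simp
  · have h1 := h i 1 _ (by norm_num) (isBlockVec_add_single hi (by norm_num))
    have h2 := h i (-1) _ (by norm_num) (isBlockVec_add_single hi (by norm_num))
    simp only [blockEig_add_single, one_mul, neg_mul, ← sub_eq_add_neg] at h1 h2
    exact ⟨h1, h2⟩

/-- A nonsingular X-type matrix is determined by its Gram matrix and its signs. -/
theorem SameSigns.eq_of_gram_eq (h : SameSigns X Y) (hX : IsXType X) (hY : IsXType Y)
    (hXu : IsUnit X) (hYu : IsUnit Y) (hgram : Xᵀ * X = Yᵀ * Y) : X = Y := by
  have hdX := (Matrix.isUnit_iff_isUnit_det X).1 hXu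
  have hdY := (Matrix.isUnit_iff_isUnit_det Y).1 hYu
  set U := X * Y⁻¹ with hU
  have hUX : IsXType U := hX.mul (hY.inv hYu)
  have hUY : U * Y = X := by rw [hU, Matrix.mul_assoc, nonsing_inv_mul _ hdY, Matrix.mul_one]
  have hUU : Uᵀ * U = 1 := by
    rw [hU, transpose_mul, Matrix.mul_assoc, ← Matrix.mul_assoc Xᵀ, hgram, Matrix.mul_assoc,
      mul_nonsing_inv _ hdY, Matrix.mul_one, ← transpose_mul, mul_nonsing_inv _ hdY, transpose_one]
  -- `Uᵀ = U⁻¹` is again X-type, so `U` is block diagonal. Its block eigenvalues have square one,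
  -- and equality of signs makes them all `1`.
  have hUt : IsXType Uᵀ := by
    rw [← inv_eq_left_inv hUU]
    exact hUX.inv (IsUnit.of_mul_eq_one _ (mul_eq_one_comm.1 hUU))
  have hsq : ∀ i s v, IsBlockVec i s v → blockEig i v U ^ 2 = 1 := by
    intro i s v hv
    rw [sq]
    nth_rewrite 1 [← hv.blockEig_transpose hUX.centro]
    rw [← hv.blockEig_mul_of_isXType hUt hUX, hUU, hv.blockEig_one]
  have hone : ∀ i s v, IsBlockVec i s v →
      SignType.sign (blockEig i v X) = SignType.sign (blockEig i v Y) → blockEig i v U = 1 := by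
    intro i s v hv hsgn
    have hmul : blockEig i v U * blockEig i v Y = blockEig i v X := by
      rw [← hv.blockEig_mul_of_isXType hUX hY, hUY]
    have hne : blockEig i v Y ≠ 0 := by
      intro h0
      have := hv.blockEig_mul_of_isXType (hY.inv hYu) hY
      rw [nonsing_inv_mul _ hdY, hv.blockEig_one, h0, mul_zero] at this
      exact one_ne_zero this
    rcases mul_self_eq_one_iff.1 <| (sq _).symm.trans (hsq i s v hv) with h1 | h1
    · exact h1
    · rw [h1] at hmul
      rw [← hmul, neg_one_mul, Left.sign_neg] at hsgn
      exact absurd (SignType.neg_eq_self_iff.1 hsgn) (sign_ne_zero.2 hne)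
  have hU1 : U = 1 := by
    ext i j
    by_cases hd : depth i = depth j
    · by_cases hi : i.rev = i
      · have hij : j = i := by
          rcases depth_eq_depth_iff.1 hd.symm with h | h
          · exact h
          · rw [h, hi]
        have := hone i 1 _ (isBlockVec_single hi) (by
          have := (h i).1
          rw [hi, ← two_mul, ← two_mul, sign_mul, sign_mul] at this
          rw [blockEig_single, blockEig_single]
          simpa using this)
        rw [blockEig_single] at this
        rw [hij, this, one_apply_eq]
      · have h1 := hone i 1 _ (isBlockVec_add_single hi (by norm_num)) (by
          simpa [blockEig_add_single] using (h i).1)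
        have h2 := hone i (-1) _ (isBlockVec_add_single hi (by norm_num)) (by
          simpa [blockEig_add_single, ← sub_eq_add_neg] using (h i).2)
        rw [blockEig_add_single] at h1 h2
        rcases depth_eq_depth_iff.1 hd.symm with h | h
        · rw [h, one_apply_eq]
          linarith
        · rw [h, one_apply_ne (Ne.symm hi)]
          linarith
    · rw [one_apply_ne fun h => hd (by rw [h])]
      rcases lt_or_gt_of_ne hd with hd | hd
      · exact hUt.blockTriangular (i := j) (j := i) hd
      · exact hUX.blockTriangular hd
  rw [← hUY, hU1, Matrix.one_mul]

end Signs

/-! ### The bound as the smaller root of a quadratic equation -/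

section Bound

variable {m n : ℕ} (Q : Matrix (Fin m) (Fin n) ℝ) (X : Matrix (Fin n) (Fin n) ℝ) {δ : ℝ}

theorem pertTerm_nonneg (hδ : 0 ≤ δ) : 0 ≤ pertTerm Q X δ :=
  add_nonneg (mul_nonneg (specNorm_nonneg _) hδ) (mul_nonneg (specNorm_nonneg _) (sq_nonneg _))

theorem pertBound_nonneg (hδ : 0 ≤ δ) : 0 ≤ pertBound Q X δ := by
  have := pertTerm_nonneg Q X hδ
  unfold pertBound
  positivity

/-- With `s` the square root, the left side equals `(1 - s²) / (1 + s) = 1 - s`. It serves both as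
contraction constant and as the margin for sign preservation. -/
theorem two_mul_specNorm_HX_mul_pertBound_lt_one
    (h : specNorm (HX X) * pertTerm Q X δ < 1 / 4) :
    2 * specNorm (HX X) * pertBound Q X δ < 1 := by
  have hs : 0 < √(1 - 4 * specNorm (HX X) * pertTerm Q X δ) := Real.sqrt_pos.2 (by linarith)
  have hs2 := Real.sq_sqrt (show 0 ≤ 1 - 4 * specNorm (HX X) * pertTerm Q X δ by linarith)
  unfold pertBound
  rw [← mul_div_assoc, div_lt_one (by linarith)]
  nlinarith

theorem pertBound_root (h : specNorm (HX X) * pertTerm Q X δ < 1 / 4) :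
    pertTerm Q X δ + specNorm (HX X) * pertBound Q X δ ^ 2 = pertBound Q X δ := by
  have hs2 := Real.sq_sqrt (show 0 ≤ 1 - 4 * specNorm (HX X) * pertTerm Q X δ by linarith)
  have hs := Real.sqrt_nonneg (1 - 4 * specNorm (HX X) * pertTerm Q X δ)
  unfold pertBound
  generalize √(1 - 4 * specNorm (HX X) * pertTerm Q X δ) = s at *
  have : 1 + s ≠ 0 := by linarith
  field_simp
  linear_combination pertTerm Q X δ * hs2

theorem pertBound_le (hδ : 0 ≤ δ) : pertBound Q X δ ≤ 2 * pertTerm Q X δ :=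
  div_le_self (mul_nonneg zero_le_two (pertTerm_nonneg Q X hδ))
    (le_add_of_nonneg_right (Real.sqrt_nonneg _))

theorem two_mul_pertTerm_le (hδ : 0 ≤ δ) (h : specNorm (HX X) * pertTerm Q X δ < 1 / 4) :
    2 * pertTerm Q X δ ≤ (1 + 2 * specNorm (GX Q X)) * δ := by
  have hG := specNorm_nonneg (GX Q X)
  have hH := specNorm_nonneg (HX X)
  -- Dropping the `G_X` term from the smallness condition leaves `(‖H_X‖₂ δ)² < 1/4`.
  have h1 : specNorm (HX X) * δ < 1 / 2 := by
    refine lt_of_pow_lt_pow_left₀ 2 (by norm_num) ?_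
    have : 0 ≤ specNorm (HX X) * (specNorm (GX Q X) * δ) := by positivity
    unfold pertTerm at h
    nlinarith
  unfold pertTerm
  nlinarith

end Bound

/-! ### Existence and uniqueness -/

section Factorization

variable {m n : ℕ} {A ΔA Q : Matrix (Fin m) (Fin n) ℝ} {X : Matrix (Fin n) (Fin n) ℝ}

theorem isUnit_of_mulVec_injective (hA : IsQX A Q X) (h : Function.Injective A.mulVec) :
    IsUnit X := by
  rw [← mulVec_injective_iff_isUnit]
  intro x y hxy
  apply h
  change X *ᵥ x = X *ᵥ y at hxy
  rw [hA.eq, ← mulVec_mulVec, hxy, mulVec_mulVec]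

theorem mulVec_injective_of_gram_eq {Y : Matrix (Fin n) (Fin n) ℝ} (h : Yᵀ * Y = Aᵀ * A)
    (hA : Function.Injective A.mulVec) : Function.Injective Y.mulVec := by
  intro x y hxy
  change Y *ᵥ x = Y *ᵥ y at hxy
  have h0 : (Aᵀ * A) *ᵥ (x - y) = 0 := by
    rw [← h, ← mulVec_mulVec, mulVec_sub, hxy, sub_self, mulVec_zero]
  rw [← conjTranspose_eq_transpose_of_trivial, conjTranspose_mul_self_mulVec_eq_zero,
    mulVec_sub, sub_eq_zero] at h0
  exact hA h0

theorem IsQX.gram_eq (hA : IsQX A Q X) : Xᵀ * X = Aᵀ * A := by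
  rw [hA.eq, transpose_mul, Matrix.mul_assoc, ← Matrix.mul_assoc Qᵀ, hA.orthogonal,
    Matrix.one_mul]

theorem IsQX.isCentrosymmetric (hA : IsQX A Q X) : IsCentrosymmetric A := by
  rw [hA.eq]
  exact (isCentrosymmetric_of_perplectic hA.perplectic hA.orthogonal).mul hA.xtype.centro

theorem IsQX.eq_mul_inv (hA : IsQX A Q X) (hX : IsUnit X) : Q = A * X⁻¹ := by
  rw [hA.eq, Matrix.mul_assoc, mul_nonsing_inv _ ((Matrix.isUnit_iff_isUnit_det X).1 hX),
    Matrix.mul_one]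

theorem isQX_of_gram_eq (hA : IsCentrosymmetric A) (hX : IsXType X) (hu : IsUnit X)
    (h : Xᵀ * X = Aᵀ * A) : IsQX A (A * X⁻¹) X := by
  have hd := (Matrix.isUnit_iff_isUnit_det X).1 hu
  have horth : (A * X⁻¹)ᵀ * (A * X⁻¹) = 1 := by
    rw [transpose_mul, Matrix.mul_assoc, ← Matrix.mul_assoc Aᵀ, ← h, Matrix.mul_assoc,
      mul_nonsing_inv _ hd, Matrix.mul_one, ← transpose_mul, mul_nonsing_inv _ hd, transpose_one]
  exact ⟨by rw [Matrix.mul_assoc, nonsing_inv_mul _ hd, Matrix.mul_one],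
    perplectic_of_isCentrosymmetric (hA.mul hX.centro.inv) horth, horth, hX⟩

/-- A QX factorization of a matrix with full column rank is determined by the signs of its
`X`-factor. -/
theorem IsQX.unique {Q₁ Q₂ : Matrix (Fin m) (Fin n) ℝ} {X₁ X₂ : Matrix (Fin n) (Fin n) ℝ}
    (h₁ : IsQX A Q₁ X₁) (h₂ : IsQX A Q₂ X₂) (hA : Function.Injective A.mulVec)
    (hs : SameSigns X₁ X₂) : Q₁ = Q₂ ∧ X₁ = X₂ := by
  have hu₁ := isUnit_of_mulVec_injective h₁ hA
  have hu₂ := isUnit_of_mulVec_injective h₂ hA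
  have hX := hs.eq_of_gram_eq h₁.xtype h₂.xtype hu₁ hu₂ (h₁.gram_eq.trans h₂.gram_eq.symm)
  exact ⟨by rw [h₁.eq_mul_inv hu₁, h₂.eq_mul_inv hu₂, hX], hX⟩

theorem SameSigns.trans {X Y Z : Matrix (Fin n) (Fin n) ℝ} (h : SameSigns X Y)
    (h' : SameSigns Y Z) : SameSigns X Z :=
  fun i => ⟨(h i).1.trans (h' i).1, (h i).2.trans (h' i).2⟩

theorem SameSigns.symm {X Y : Matrix (Fin n) (Fin n) ℝ} (h : SameSigns X Y) : SameSigns Y X :=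
  fun i => ⟨(h i).1.symm, (h i).2.symm⟩

/-- X-type matrices near a nonsingular X-type matrix have the same signs. -/
theorem sameSigns_of_frobNorm_le {Y : Matrix (Fin n) (Fin n) ℝ} {ρ : ℝ} (hX : IsXType X)
    (hu : IsUnit X) (hY : IsXType Y) (hρ : frobNorm (Y - X) ≤ ρ)
    (hlt : 2 * specNorm (HX X) * ρ < 1) : SameSigns X Y := by
  refine sameSigns_of_blockEig fun i s v hs hv => ?_
  have h1 := hv.one_le_two_mul_specNorm_HX hs hX hu
  have h2 := (hv.abs_blockEig_le (hY.sub hX).centro).trans hρ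
  have hH := specNorm_nonneg (HX X)
  have hsub : blockEig i v (Y - X) = blockEig i v Y - blockEig i v X := by
    simp [blockEig, sub_mulVec]
  -- After multiplication by `2 ‖H_X‖₂` the left side is below `1` and the right side is at least
  -- `1`.
  have h3 : |blockEig i v Y - blockEig i v X| < |blockEig i v X| := by
    rw [← hsub]
    refine lt_of_mul_lt_mul_left (a := 2 * specNorm (HX X)) ?_ (by positivity)
    refine lt_of_lt_of_le ?_ h1
    exact lt_of_le_of_lt (mul_le_mul_of_nonneg_left h2 (by positivity)) hlt
  rcases lt_trichotomy (blockEig i v X) 0 with h | h | h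
  · rw [abs_of_neg h, abs_lt] at h3
    rw [sign_neg h, sign_neg (by linarith)]
  · rw [h, abs_zero] at h3
    exact absurd h3 (abs_nonneg _).not_gt
  · rw [abs_of_pos h, abs_lt] at h3
    rw [sign_pos h, sign_pos (by linarith)]

/-- The map whose fixed points are the solutions `ΔX` of the perturbed Gram equation. -/
noncomputable def perturbMap (Q ΔA : Matrix (Fin m) (Fin n) ℝ) (X Z : Matrix (Fin n) (Fin n) ℝ) :
    Matrix (Fin n) (Fin n) ℝ :=
  upx (Qᵀ * ΔA * X⁻¹ + (X⁻¹)ᵀ * ΔAᵀ * Q + (X⁻¹)ᵀ * (ΔAᵀ * ΔA - Zᵀ * Z) * X⁻¹) * X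

theorem isXType_perturbMap {Z : Matrix (Fin n) (Fin n) ℝ} (hQ : IsCentrosymmetric Q)
    (hΔA : IsCentrosymmetric ΔA) (hX : IsXType X) (hZ : IsXType Z) :
    IsXType (perturbMap Q ΔA X Z) := by
  have hY := hX.centro.inv
  refine (isXType_upx (IsCentrosymmetric.add (IsCentrosymmetric.add ?_ ?_) ?_)).mul hX
  · exact (hQ.transpose.mul hΔA).mul hY
  · exact (hY.transpose.mul hΔA.transpose).mul hQ
  · exact (hY.transpose.mul
      ((hΔA.transpose.mul hΔA).sub (hZ.centro.transpose.mul hZ.centro))).mul hY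

theorem frobNorm_perturbMap_le (hX : IsXType X) (Z : Matrix (Fin n) (Fin n) ℝ) :
    frobNorm (perturbMap Q ΔA X Z) ≤
      pertTerm Q X (frobNorm ΔA) + specNorm (HX X) * frobNorm Z ^ 2 := by
  have hsq : ∀ {k : ℕ} (E : Matrix (Fin k) (Fin n) ℝ), frobNorm (Eᵀ * E) ≤ frobNorm E ^ 2 := by
    intro k E
    rw [sq]
    nth_rewrite 2 [← frobNorm_transpose]
    exact frobNorm_mul_le _ _
  have h1 := frobNorm_upx_mul_le_GX hX Q ΔA
  have h2 := frobNorm_upx_mul_le_HX hX (ΔAᵀ * ΔA - Zᵀ * Z)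
  have h3 := frobNorm_sub_le (ΔAᵀ * ΔA) (Zᵀ * Z)
  have h4 : frobNorm (ΔAᵀ * ΔA - Zᵀ * Z) ≤ frobNorm ΔA ^ 2 + frobNorm Z ^ 2 :=
    h3.trans (add_le_add (hsq _) (hsq _))
  have h5 := mul_le_mul_of_nonneg_left h4 (specNorm_nonneg (HX X))
  rw [perturbMap, upx_add, Matrix.add_mul]
  refine (frobNorm_add_le _ _).trans ?_
  rw [pertTerm]
  linarith

/-- Only the quadratic term survives in the difference, and `Wᵀ W - Zᵀ Z = Wᵀ (W - Z) + (W - Z)ᵀ Z`.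
-/
theorem frobNorm_perturbMap_sub_le (hX : IsXType X) (Z W : Matrix (Fin n) (Fin n) ℝ) :
    frobNorm (perturbMap Q ΔA X Z - perturbMap Q ΔA X W) ≤
      specNorm (HX X) * ((frobNorm Z + frobNorm W) * frobNorm (Z - W)) := by
  have h : perturbMap Q ΔA X Z - perturbMap Q ΔA X W =
      upx ((X⁻¹)ᵀ * (Wᵀ * W - Zᵀ * Z) * X⁻¹) * X := by
    rw [perturbMap, perturbMap, ← Matrix.sub_mul, ← upx_sub]
    congr 2
    noncomm_ring
  rw [h]
  refine (frobNorm_upx_mul_le_HX hX _).trans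
    (mul_le_mul_of_nonneg_left ?_ (specNorm_nonneg _))
  have h2 : Wᵀ * W - Zᵀ * Z = Wᵀ * (W - Z) + (W - Z)ᵀ * Z := by
    rw [transpose_sub]
    noncomm_ring
  rw [h2, frobNorm_sub_comm Z W]
  refine (frobNorm_add_le _ _).trans ?_
  have h3 := frobNorm_mul_le Wᵀ (W - Z)
  have h4 := frobNorm_mul_le (W - Z)ᵀ Z
  rw [frobNorm_transpose] at h3 h4
  linarith

/-- Placing `upx C + (upx C)ᵀ = C` between `Xᵀ` and `X` turns the left side into `Xᵀ Z + Zᵀ X`, and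
the right side into the increment of the Gram matrix minus `Zᵀ Z`. -/
theorem gram_eq_of_perturbMap_eq {Z : Matrix (Fin n) (Fin n) ℝ} (hA : IsQX A Q X)
    (hu : IsUnit X) (hZ : perturbMap Q ΔA X Z = Z) :
    (X + Z)ᵀ * (X + Z) = (A + ΔA)ᵀ * (A + ΔA) := by
  have hd := (Matrix.isUnit_iff_isUnit_det X).1 hu
  have hXX := mul_nonsing_inv _ hd
  have hYX := nonsing_inv_mul _ hd
  have hXY : Xᵀ * (X⁻¹)ᵀ = 1 := by rw [← transpose_mul, hYX, transpose_one]
  set C := Qᵀ * ΔA * X⁻¹ + (X⁻¹)ᵀ * ΔAᵀ * Q + (X⁻¹)ᵀ * (ΔAᵀ * ΔA - Zᵀ * Z) * X⁻¹ with hC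
  have hCt : Cᵀ = C := by
    simp only [hC, transpose_add, transpose_mul, transpose_sub, transpose_transpose,
      Matrix.mul_assoc]
    abel
  have hU := upx_add_transpose_upx hCt
  have hZ' : upx C * X = Z := hZ
  have hlhs : Xᵀ * (upx C + (upx C)ᵀ) * X = Xᵀ * Z + Zᵀ * X := by
    rw [Matrix.mul_add, Matrix.add_mul, Matrix.mul_assoc, hZ', ← transpose_mul, hZ']
  have hrhs : Xᵀ * C * X = Aᵀ * ΔA + ΔAᵀ * A + (ΔAᵀ * ΔA - Zᵀ * Z) := by
    have h1 : Xᵀ * (Qᵀ * ΔA * X⁻¹) * X = Aᵀ * ΔA := by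
      rw [Matrix.mul_assoc, Matrix.mul_assoc _ X⁻¹, hYX, Matrix.mul_one, ← Matrix.mul_assoc,
        ← transpose_mul, ← hA.eq]
    have h2 : ∀ M : Matrix (Fin n) (Fin n) ℝ, Xᵀ * ((X⁻¹)ᵀ * M) = M := fun M => by
      rw [← Matrix.mul_assoc, hXY, Matrix.one_mul]
    rw [hC, Matrix.mul_add, Matrix.mul_add, Matrix.add_mul, Matrix.add_mul, h1]
    congr 1
    · rw [Matrix.mul_assoc (X⁻¹)ᵀ, h2, Matrix.mul_assoc, ← hA.eq]
    · rw [Matrix.mul_assoc (X⁻¹)ᵀ, h2, Matrix.mul_assoc, hYX, Matrix.mul_one]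
  rw [hU, hrhs] at hlhs
  have hXA := hA.gram_eq
  simp only [transpose_add, Matrix.add_mul, Matrix.mul_add, hXA]
  have h := congrArg (fun M => Aᵀ * A + Zᵀ * Z + M) hlhs
  calc _ = Aᵀ * A + Zᵀ * Z + (Xᵀ * Z + Zᵀ * X) := by abel
    _ = _ := by rw [← hlhs]; abel

/-- A small perturbation of the Gram matrix of `A` is the Gram matrix of an X-type matrix near
`X`. -/
theorem exists_isXType_gram_eq (hA : IsQX A Q X) (hu : IsUnit X) (hΔA : IsCentrosymmetric ΔA)
    (hmain : specNorm (HX X) * pertTerm Q X (frobNorm ΔA) < 1 / 4) :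
    ∃ Z, IsXType Z ∧ frobNorm Z ≤ pertBound Q X (frobNorm ΔA) ∧
      (X + Z)ᵀ * (X + Z) = (A + ΔA)ᵀ * (A + ΔA) := by
  have hQ := isCentrosymmetric_of_perplectic hA.perplectic hA.orthogonal
  have hH := specNorm_nonneg (HX X)
  -- With this local instance the abstract norm unfolds to `frobNorm`.
  let _ := (Matrix.frobeniusNormedAddCommGroup : NormedAddCommGroup (Matrix (Fin n) (Fin n) ℝ))
  let _ := (Matrix.frobeniusNormedSpace : NormedSpace ℝ (Matrix (Fin n) (Fin n) ℝ))
  obtain ⟨Z, hZ, hρ, hfix⟩ := exists_fixedPoint_of_lipschitz (xTypeSubmodule n)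
    (perturbMap Q ΔA X) (pertBound_nonneg Q X (frobNorm_nonneg ΔA))
    (two_mul_specNorm_HX_mul_pertBound_lt_one Q X hmain)
    (fun Z hZ => isXType_perturbMap hQ hΔA hA.xtype hZ)
    (fun Z _ hZ => by
      refine (frobNorm_perturbMap_le hA.xtype Z).trans ?_
      refine le_trans ?_ (pertBound_root Q X hmain).le
      gcongr
      · exact frobNorm_nonneg Z
      · exact hZ)
    (fun Z _ W _ hZ hW => by
      refine (frobNorm_perturbMap_sub_le hA.xtype Z W).trans ?_
      have h1 : frobNorm Z + frobNorm W ≤ 2 * pertBound Q X (frobNorm ΔA) := by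
        have h1 : frobNorm Z ≤ _ := hZ
        have h2 : frobNorm W ≤ _ := hW
        linarith
      have h2 := mul_le_mul_of_nonneg_left
        (mul_le_mul_of_nonneg_right h1 (frobNorm_nonneg (Z - W))) hH
      refine h2.trans_eq ?_
      change _ = _ * frobNorm (Z - W)
      ring)
  exact ⟨Z, hZ, hρ, gram_eq_of_perturbMap_eq hA hu hfix⟩

end Factorization

end QXFact

open QXFact in
theorem theorem2p2 {m n : ℕ} (A ΔA Q : Matrix (Fin m) (Fin n) ℝ) (X : Matrix (Fin n) (Fin n) ℝ)
    (A' : Matrix (Fin n) (Fin m) ℝ)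
    (hrank : A.rank = n) (hA : IsQX A Q X) (hΔA : IsCentrosymmetric ΔA)
    (hA' : IsMoorePenrose A A') (hsmall : specNorm (ΔA * A') < 1)
    (hmain : specNorm (HX X) * pertTerm Q X (frobNorm ΔA) < 1 / 4) :
    ∃ (ΔQ : Matrix (Fin m) (Fin n) ℝ) (ΔX : Matrix (Fin n) (Fin n) ℝ),
      -- existence of the factorization
      IsQX (A + ΔA) (Q + ΔQ) (X + ΔX) ∧ SameSigns X (X + ΔX) ∧
      -- uniqueness among the factorizations with the signs of `X`
      (∀ Q₁ X₁, IsQX (A + ΔA) Q₁ X₁ → SameSigns X X₁ → Q₁ = Q + ΔQ ∧ X₁ = X + ΔX) ∧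
      -- uniqueness among the factorizations satisfying the bound
      (∀ Q₁ X₁, IsQX (A + ΔA) Q₁ X₁ → frobNorm (X₁ - X) ≤ pertBound Q X (frobNorm ΔA) →
        Q₁ = Q + ΔQ ∧ X₁ = X + ΔX) ∧
      -- the bounds
      frobNorm ΔX ≤ pertBound Q X (frobNorm ΔA) ∧
      pertBound Q X (frobNorm ΔA) ≤ 2 * pertTerm Q X (frobNorm ΔA) ∧
      2 * pertTerm Q X (frobNorm ΔA) ≤ (1 + 2 * specNorm (GX Q X)) * frobNorm ΔA := by
  have hinj : Function.Injective A.mulVec := by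
    rw [Matrix.mulVec_injective_iff, linearIndependent_iff_card_eq_finrank_span, Set.finrank,
      ← Matrix.rank_eq_finrank_span_cols, hrank, Fintype.card_fin]
  have hu := isUnit_of_mulVec_injective hA hinj
  -- Full column rank allows cancelling `A` on the left in `A A' A = A`.
  have hleft : A' * A = 1 := by
    refine Matrix.ext_of_mulVec_single fun j => hinj ?_
    rw [Matrix.mulVec_mulVec, Matrix.mulVec_mulVec, ← Matrix.mul_assoc, hA'.mul_mul_left,
      Matrix.mul_one]
  have hinj' := mulVec_add_injective_of_specNorm_lt_one hleft hsmall
  have hδ := frobNorm_nonneg ΔA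
  have hlt := two_mul_specNorm_HX_mul_pertBound_lt_one Q X hmain
  obtain ⟨Z, hZ, hρ, hgram⟩ := exists_isXType_gram_eq hA hu hΔA hmain
  have hXZ := hA.xtype.add hZ
  -- `X + Z` has the Gram matrix, hence the kernel, of `A + ΔA`.
  have hXZu : IsUnit (X + Z) := by
    rw [← Matrix.mulVec_injective_iff_isUnit]
    exact mulVec_injective_of_gram_eq hgram hinj'
  have hQX := isQX_of_gram_eq (hA.isCentrosymmetric.add hΔA) hXZ hXZu hgram
  have hsign := sameSigns_of_frobNorm_le hA.xtype hu hXZ (by rwa [add_sub_cancel_left]) hlt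
  refine ⟨(A + ΔA) * (X + Z)⁻¹ - Q, Z, ?_, hsign, ?_, ?_, hρ, pertBound_le Q X hδ,
    two_mul_pertTerm_le Q X hδ hmain⟩
  · rwa [add_sub_cancel]
  · intro Q₁ X₁ h hs
    rw [add_sub_cancel]
    exact h.unique hQX hinj' (hs.symm.trans hsign)
  -- The bound forces the signs of `X`, which reduces this case to uniqueness by signs.
  · intro Q₁ X₁ h hb
    rw [add_sub_cancel]
    exact h.unique hQX hinj'
      ((sameSigns_of_frobNorm_le hA.xtype hu h.xtype hb hlt).symm.trans hsign)
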